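/- **Theorem (Pointwise estimate).** Let $n \ge 2$. There exists a constant $C = C(n) \in (0,\infty)$, depending only on $n$, such that for every open set $\Omega \subset \mathbb{R}^n$ (no boundedness or regularity is assumed) and every vector field $u \in E^{1,1}(\Omega) \cap C_b(\overline\Omega)$, $$|u(x)| \le C \int_{\mathbb{S}^{n-1}} |u(\zeta(x,\vartheta))| \, d\mathcal{H}^{n-1}(\vartheta) + C \int_\Omega \frac{|\mathcal{E}u(y)|}{|x-y|^{n-1}} \, dy \qquad \text{for every } x \in \Omega,$$ where the right-hand side may be $+\infty$. Here: - $\mathcal{E}u = \tfrac12\big(\nabla u + (\nabla u)^T\big)$ is the symmetric part of the distributional gradient of $u$, and $|\mathcal E u|$ is its Euclidean (Frobenius) norm; - $E^{1,1}(\Omega)$ is the space of the vector fields $u : \Omega \to \mathbb{R}^n$ in $L^1_{\rm loc}(\Omega)$ such that $\mathcal{E}u$ is a function with $|\mathcal{E}u| \in L^1(\Omega)$; - $C_b(\overline\Omega)$ is the space of the vector fields $u : \overline\Omega \to \mathbb{R}^n$ that are continuous in $\overline\Omega$ and have bounded support; - $\mathbb{S}^{n-1}$ is the unit sphere in $\mathbb{R}^n$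 and $\mathcal{H}^{n-1}$ is the $(n-1)$-dimensional Hausdorff measure; - for $x \in \Omega$ and $\vartheta \in \mathbb{S}^{n-1}$ such that $x + t\vartheta \in \partial\Omega$ for some $t > 0$, $\zeta(x,\vartheta)$ is the first point of $\partial\Omega$ on the ray $\{x + t\vartheta : t > 0\}$; if the ray does not meet $\partial\Omega$, then $u(\zeta(x,\vartheta))$ is taken to be $0$. -/

import Mathlib

open MeasureTheory Set
open scoped ContDiff ENNReal NNReal

/-- `G` is (a representative of) the distributional symmetric gradient
`(∇u + (∇u)ᵀ) / 2` of the vector field `u` in the open set `Ω`, and it is a locally integrable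
function: for all indices `i, j` and every smooth real-valued `φ` with compact support in `Ω`,
`∫_Ω (u_i ∂_j φ + u_j ∂_i φ) / 2 = - ∫_Ω G_ij φ`.
Matrices are families of `n × n` entries with the Euclidean (Frobenius) norm. -/
def HasWeakSymGradient {n : ℕ} (Ω : Set (EuclideanSpace ℝ (Fin n)))
    (u : EuclideanSpace ℝ (Fin n) → EuclideanSpace ℝ (Fin n))
    (G : EuclideanSpace ℝ (Fin n) → EuclideanSpace ℝ (Fin n × Fin n)) : Prop :=
  LocallyIntegrableOn u Ω ∧ LocallyIntegrableOn G Ω ∧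
    ∀ i j : Fin n, ∀ φ : EuclideanSpace ℝ (Fin n) → ℝ,
      ContDiff ℝ ∞ φ → HasCompactSupport φ → tsupport φ ⊆ Ω →
        ∫ y in Ω, (u y i * fderiv ℝ φ y (EuclideanSpace.single j 1)
            + u y j * fderiv ℝ φ y (EuclideanSpace.single i 1)) / 2
          = - ∫ y in Ω, G y (i, j) * φ y

/-- The space `E^{1,p}(Ω)` of the vector fields in `L¹_loc(Ω)` whose distributional symmetric
gradient belongs to `L^p(Ω)`. -/
def MemE {n : ℕ} (p : ℝ≥0∞) (Ω : Set (EuclideanSpace ℝ (Fin n)))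
    (u : EuclideanSpace ℝ (Fin n) → EuclideanSpace ℝ (Fin n)) : Prop :=
  ∃ G, HasWeakSymGradient Ω u G ∧ MemLp G p (volume.restrict Ω)

/-- The space `C_b(Ω̄)` of the vector fields that are continuous in the closure of `Ω` and have
bounded support there. (Values outside the closure are irrelevant.) -/
def MemCb {n : ℕ} (Ω : Set (EuclideanSpace ℝ (Fin n)))
    (u : EuclideanSpace ℝ (Fin n) → EuclideanSpace ℝ (Fin n)) : Prop :=
  ContinuousOn u (closure Ω) ∧ Bornology.IsBounded (closure Ω ∩ Function.support u)

/-- The times `t > 0` at which the ray issued from `x` in the direction `θ` is on `∂Ω`. -/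
def hitTimes {n : ℕ} (Ω : Set (EuclideanSpace ℝ (Fin n))) (x θ : EuclideanSpace ℝ (Fin n)) :
    Set ℝ :=
  {t | 0 < t ∧ x + t • θ ∈ frontier Ω}

/-- The first point `ζ(x, θ)` of `∂Ω` on the ray issued from `x` in the direction `θ`
(meaningful when the ray meets `∂Ω`). -/
noncomputable def firstHit {n : ℕ} (Ω : Set (EuclideanSpace ℝ (Fin n)))
    (x θ : EuclideanSpace ℝ (Fin n)) : EuclideanSpace ℝ (Fin n) :=
  x + sInf (hitTimes Ω x θ) • θ

open Classical in
/-- The value `g(ζ(x, θ))`, with the convention that it is `0` if the ray issued from `x` in the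
direction `θ` does not meet `∂Ω`. -/
noncomputable def boundaryValue {n : ℕ} (Ω : Set (EuclideanSpace ℝ (Fin n)))
    (g : EuclideanSpace ℝ (Fin n) → EuclideanSpace ℝ (Fin n))
    (x θ : EuclideanSpace ℝ (Fin n)) : EuclideanSpace ℝ (Fin n) :=
  if (hitTimes Ω x θ).Nonempty then g (firstHit Ω x θ) else 0

/-- If the ray meets `∂Ω`, then its first hitting time is positive, `ζ(x, θ)` is in `∂Ω`, and
the points of the ray strictly between `x` and `ζ(x, θ)` are in `Ω`. -/
theorem firstHit_spec {n : ℕ} {Ω : Set (EuclideanSpace ℝ (Fin n))} (hΩ : IsOpen Ω)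
    {x θ : EuclideanSpace ℝ (Fin n)} (hx : x ∈ Ω) (h : (hitTimes Ω x θ).Nonempty) :
    0 < sInf (hitTimes Ω x θ) ∧ firstHit Ω x θ ∈ frontier Ω ∧
      ∀ t ∈ Ioo 0 (sInf (hitTimes Ω x θ)), x + t • θ ∈ Ω := by
  have hc : Continuous fun t : ℝ => x + t • θ := by fun_prop
  have hx' : x ∉ frontier Ω := by
    rw [hΩ.frontier_eq]; exact fun h => h.2 hx
  have heq : hitTimes Ω x θ = Ici 0 ∩ (fun t : ℝ => x + t • θ) ⁻¹' frontier Ω := by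
    ext t
    constructor
    · exact fun ht => ⟨ht.1.le, ht.2⟩
    · rintro ⟨h0, h1⟩
      refine ⟨lt_of_le_of_ne h0 ?_, h1⟩
      rintro rfl
      exact hx' (by simpa using h1)
  have hcl : IsClosed (hitTimes Ω x θ) := by
    rw [heq]; exact isClosed_Ici.inter (isClosed_frontier.preimage hc)
  have hb : BddBelow (hitTimes Ω x θ) := ⟨0, fun t ht => ht.1.le⟩
  have hmem := hcl.csInf_mem h hb
  refine ⟨hmem.1, hmem.2, fun t ht => ?_⟩
  by_contra hn
  have hpre : IsPreconnected ((fun t : ℝ => x + t • θ) '' Icc 0 t) :=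
    isPreconnected_Icc.image _ hc.continuousOn
  have hfr : ∃ s ∈ Icc 0 t, x + s • θ ∈ frontier Ω := by
    by_contra! hno
    obtain ⟨y, -, hy1, hy2⟩ := hpre Ω (closure Ω)ᶜ hΩ isClosed_closure.isOpen_compl
      (by
        rintro _ ⟨s, hs, rfl⟩
        have h1 := hno s hs
        rw [hΩ.frontier_eq] at h1
        by_cases h2 : x + s • θ ∈ Ω
        · exact Or.inl h2
        · exact Or.inr fun h3 => h1 ⟨h3, h2⟩)
      ⟨x, ⟨0, ⟨le_rfl, ht.1.le⟩, by simp⟩, hx⟩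
      ⟨_, ⟨t, ⟨ht.1.le, le_rfl⟩, rfl⟩, fun h3 => hno t ⟨ht.1.le, le_rfl⟩ (by
        rw [hΩ.frontier_eq]; exact ⟨h3, hn⟩)⟩
    exact hy2 (subset_closure hy1)
  obtain ⟨s, hs, hy⟩ := hfr
  have hs' : s ∈ hitTimes Ω x θ := by rw [heq]; exact ⟨hs.1, hy⟩
  exact absurd (csInf_le hb hs') (not_le.2 (lt_of_le_of_lt hs.2 ht.2))

/-! For a unit vector `θ`, the derivative along `θ` of the component of `u` along `θ` is the
quadratic form of `𝓔u` at `θ`: the antisymmetric part of the gradient drops out. Integrating from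
`x` to the first boundary point bounds `|θ·u(x)|` by `|u(ζ(x,θ))|` plus the integral of `|𝓔u|` along
the ray. After averaging over `θ`, the left side controls `|u(x)|`
(`exists_mul_enorm_le_lintegral_toSphere_inner`), and polar coordinates turn the ray integrals into
the Riesz potential of `|𝓔u|`.

Since `𝓔u` is only a weak derivative, the ray estimate is proved for mollifications and kept as a
liminf (`HasWeakSymGradient.enorm_inner_le_boundaryValue_add`). The ray integrals start at a
distance from `x` equal to the mollification radius; beyond it, mollifying the kernel costs at most
a factor `2^(n-1)` (`lintegral_toSphere_lintegral_mollified_le`). Fatou's lemma then removes the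
mollification. Finally `exists_toSphere_le_smul_hausdorffMeasure` passes to the Hausdorff measure.
-/

open Filter Topology

/-! ### Estimates along rays by mollification. -/

section WeakSymGradient

theorem MeasureTheory.LocallyIntegrableOn.integrableOn_mul_of_tsupport_subset {E : Type*}
    [NormedAddCommGroup E] [MeasurableSpace E] [OpensMeasurableSpace E]
    [SecondCountableTopology E] {μ : Measure E}
    {Ω : Set E} {f φ : E → ℝ} (hf : LocallyIntegrableOn f Ω μ) (hφ : Continuous φ)
    (hc : HasCompactSupport φ) (hs : tsupport φ ⊆ Ω) :
    IntegrableOn (fun y => f y * φ y) Ω μ := by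
  have h1 : IntegrableOn f (tsupport φ) μ := hf.integrableOn_compact_subset hs hc
  have h2 : IntegrableOn (fun y => f y * φ y) (tsupport φ) μ :=
    h1.mul_continuousOn hφ.continuousOn hc
  refine (h2.integrable_of_forall_notMem_eq_zero fun y hy => ?_).integrableOn
  rw [image_eq_zero_of_notMem_tsupport hy, mul_zero]

variable {n : ℕ}

/-- Contract the weak identity with `θ ⊗ θ`: this tensor is symmetric, so symmetrising the gradient
changes nothing. -/
theorem HasWeakSymGradient.integral_inner_mul_fderiv
    {Ω : Set (EuclideanSpace ℝ (Fin n))} {u : EuclideanSpace ℝ (Fin n) → EuclideanSpace ℝ (Fin n)}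
    {G : EuclideanSpace ℝ (Fin n) → EuclideanSpace ℝ (Fin n × Fin n)}
    (h : HasWeakSymGradient Ω u G) {φ : EuclideanSpace ℝ (Fin n) → ℝ}
    (hφ : ContDiff ℝ ∞ φ) (hc : HasCompactSupport φ) (hs : tsupport φ ⊆ Ω)
    (θ : EuclideanSpace ℝ (Fin n)) :
    ∫ y in Ω, inner ℝ θ (u y) * fderiv ℝ φ y θ
      = - ∫ y in Ω, (∑ i, ∑ j, θ i * θ j * G y (i, j)) * φ y := by
  obtain ⟨hu, hG, hw⟩ := h
  have hui : ∀ i, LocallyIntegrableOn (fun y => u y i) Ω := fun i y hy => by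
    obtain ⟨s, hs, h⟩ := hu y hy
    exact ⟨s, hs, (EuclideanSpace.proj (𝕜 := ℝ) i).integrable_comp h⟩
  have hGi : ∀ p, LocallyIntegrableOn (fun y => G y p) Ω := fun i y hy => by
    obtain ⟨s, hs, h⟩ := hG y hy
    exact ⟨s, hs, (EuclideanSpace.proj (𝕜 := ℝ) i).integrable_comp h⟩
  have hD : ∀ i j, IntegrableOn
      (fun y => u y i * fderiv ℝ φ y (EuclideanSpace.single j 1)) Ω := fun i j =>
    (hui i).integrableOn_mul_of_tsupport_subset
      ((hφ.continuous_fderiv (by simp)).clm_apply continuous_const)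
      (hc.fderiv_apply (𝕜 := ℝ) _)
      ((tsupport_fderiv_apply_subset ℝ _).trans hs)
  have hGφ : ∀ p, IntegrableOn (fun y => G y p * φ y) Ω := fun p =>
    (hGi p).integrableOn_mul_of_tsupport_subset hφ.continuous hc hs
  have hθ : θ = ∑ j, θ j • EuclideanSpace.single j (1 : ℝ) := by
    ext k; simp [Pi.single_apply]
  have e1 : ∀ y, inner ℝ θ (u y) * fderiv ℝ φ y θ = ∑ i, ∑ j, θ i * θ j *
      ((u y i * fderiv ℝ φ y (EuclideanSpace.single j 1)
            + u y j * fderiv ℝ φ y (EuclideanSpace.single i 1)) / 2) := by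
    intro y
    have e2 : fderiv ℝ φ y θ = ∑ j, θ j * fderiv ℝ φ y (EuclideanSpace.single j 1) := by
      conv_lhs => rw [hθ]
      simp
    have e3 : inner ℝ θ (u y) = ∑ i, θ i * u y i := by
      simp [PiLp.inner_apply, mul_comm]
    have e4 : inner ℝ θ (u y) * fderiv ℝ φ y θ = ∑ i, ∑ j, θ i * θ j *
      (u y i * fderiv ℝ φ y (EuclideanSpace.single j 1)) := by
      rw [e2, e3, Finset.sum_mul_sum]
      refine Finset.sum_congr rfl fun i _ => Finset.sum_congr rfl fun j _ => by ring
    have e5 : inner ℝ θ (u y) * fderiv ℝ φ y θ = ∑ i, ∑ j, θ i * θ j *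
      (u y j * fderiv ℝ φ y (EuclideanSpace.single i 1)) := by
      rw [e4, Finset.sum_comm]
      refine Finset.sum_congr rfl fun i _ => Finset.sum_congr rfl fun j _ => by ring
    -- Averaging the two expansions, which differ by exchanging the indices, produces the
    -- symmetrised integrand.
    have e6 : inner ℝ θ (u y) * fderiv ℝ φ y θ
      = (inner ℝ θ (u y) * fderiv ℝ φ y θ + inner ℝ θ (u y) * fderiv ℝ φ y θ) / 2 := by ring
    rw [e6]
    nth_rewrite 1 [e4]
    rw [e5, ← Finset.sum_add_distrib, Finset.sum_div]
    refine Finset.sum_congr rfl fun i _ => ?_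
    rw [← Finset.sum_add_distrib, Finset.sum_div]
    exact Finset.sum_congr rfl fun j _ => by ring
  have i1 : ∀ i j, IntegrableOn (fun y => θ i * θ j *
      ((u y i * fderiv ℝ φ y (EuclideanSpace.single j 1)
            + u y j * fderiv ℝ φ y (EuclideanSpace.single i 1)) / 2)) Ω := fun i j =>
    (((hD i j).add (hD j i)).div_const 2).const_mul _
  simp_rw [e1, Finset.sum_mul]
  rw [integral_finsetSum _ fun i _ => integrable_finsetSum _ fun j _ => i1 i j,
    integral_finsetSum _ fun i _ => integrable_finsetSum _ fun j _ => by
      simpa only [mul_assoc] using (hGφ (i, j)).const_mul (θ i * θ j), ← Finset.sum_neg_distrib]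
  refine Finset.sum_congr rfl fun i _ => ?_
  rw [integral_finsetSum _ fun j _ => i1 i j,
    integral_finsetSum _ fun j _ => by
      simpa only [mul_assoc] using (hGφ (i, j)).const_mul (θ i * θ j), ← Finset.sum_neg_distrib]
  refine Finset.sum_congr rfl fun j _ => ?_
  rw [integral_const_mul, hw i j φ hφ hc hs, mul_neg, ← integral_const_mul]
  simp only [mul_assoc]

/-- Cauchy–Schwarz against `θ ⊗ θ`, whose Frobenius norm is 1. -/
theorem abs_sum_mul_mul_le_norm {θ : EuclideanSpace ℝ (Fin n)} (hθ : ‖θ‖ = 1)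
    (A : EuclideanSpace ℝ (Fin n × Fin n)) :
    |∑ i, ∑ j, θ i * θ j * A (i, j)| ≤ ‖A‖ := by
  have h1 : ∑ i, ∑ j, θ i * θ j * A (i, j)
      = inner ℝ A (WithLp.toLp 2 fun p : Fin n × Fin n => θ p.1 * θ p.2) := by
    simp [PiLp.inner_apply, Fintype.sum_prod_type]
  have h2 : ‖(WithLp.toLp 2 fun p : Fin n × Fin n => θ p.1 * θ p.2)‖ = 1 := by
    have h3 : ∑ i, θ i ^ 2 = 1 := by
      have := EuclideanSpace.real_norm_sq_eq θ
      rw [hθ] at this; linarith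
    rw [EuclideanSpace.norm_eq, Real.sqrt_eq_one]
    simp_rw [Real.norm_eq_abs, sq_abs, Fintype.sum_prod_type, mul_pow, ← Finset.mul_sum, h3,
      mul_one, h3]
  rw [h1]
  simpa [h2] using abs_real_inner_le_norm A (WithLp.toLp 2 fun p : Fin n × Fin n => θ p.1 * θ p.2)

open scoped Convolution in
/-- The derivative along `θ` of the mollified component of `u` along `θ` is controlled by the
mollified symmetric gradient. -/
theorem HasWeakSymGradient.enorm_fderiv_convolution_le
    {Ω : Set (EuclideanSpace ℝ (Fin n))} {u : EuclideanSpace ℝ (Fin n) → EuclideanSpace ℝ (Fin n)}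
    {G : EuclideanSpace ℝ (Fin n) → EuclideanSpace ℝ (Fin n × Fin n)}
    (h : HasWeakSymGradient Ω u G) (hΩ : IsOpen Ω)
    {θ : EuclideanSpace ℝ (Fin n)} (hθ : ‖θ‖ = 1)
    (hu : LocallyIntegrable (Ω.indicator fun z => inner ℝ θ (u z)))
    {g : EuclideanSpace ℝ (Fin n) → ℝ≥0∞} (hg : ∀ᵐ z, z ∈ Ω → ‖G z‖ₑ ≤ g z)
    (ρ : ContDiffBump (0 : EuclideanSpace ℝ (Fin n))) {y : EuclideanSpace ℝ (Fin n)}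
    (hy : Metric.closedBall y ρ.rOut ⊆ Ω) :
    ‖fderiv ℝ (Ω.indicator (fun z => inner ℝ θ (u z)) ⋆[ContinuousLinearMap.lsmul ℝ ℝ]
        ρ.normed volume) y θ‖ₑ ≤ ∫⁻ z, ‖ρ.normed volume (y - z)‖ₑ * g z := by
  set w := Ω.indicator fun z => inner ℝ θ (u z)
  set r : EuclideanSpace ℝ (Fin n) → ℝ := ρ.normed volume
  have hr : ContDiff ℝ ∞ r := ρ.contDiff_normed
  have hrc : HasCompactSupport r := ρ.hasCompactSupport_normed
  rw [(hrc.hasFDerivAt_convolution_right (ContinuousLinearMap.lsmul ℝ ℝ) hu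
      (hr.of_le (by simp)) y).fderiv,
    convolution_precompR_apply _ hu (hrc.fderiv ℝ) (hr.continuous_fderiv (by simp)), convolution_def]
  -- The reflected mollifier is the test function. Reflection changes the sign of its derivative,
  -- which cancels the minus sign of the weak identity.
  set φ : EuclideanSpace ℝ (Fin n) → ℝ := fun z => r (y - z)
  have hφ : ContDiff ℝ ∞ φ := hr.comp (contDiff_const.sub contDiff_id)
  have hsupp : Function.support φ ⊆ Metric.closedBall y ρ.rOut := by
    intro z hz
    have : y - z ∈ Function.support r := hz
    rw [ρ.support_normed_eq] at this
    rw [Metric.mem_closedBall, dist_comm, dist_eq_norm]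
    simpa using (mem_ball_zero_iff.1 this).le
  have hts : tsupport φ ⊆ Metric.closedBall y ρ.rOut :=
    closure_minimal hsupp Metric.isClosed_closedBall
  have hφc : HasCompactSupport φ := HasCompactSupport.of_support_subset_isCompact
    (isCompact_closedBall y ρ.rOut) hsupp
  have hfd : ∀ z, fderiv ℝ φ z θ = - fderiv ℝ r (y - z) θ := by
    intro z
    have h1 : HasFDerivAt φ ((fderiv ℝ r (y - z)).comp
        (-(ContinuousLinearMap.id ℝ (EuclideanSpace ℝ (Fin n))))) z :=
      ((hr.differentiable (by simp)) (y - z)).hasFDerivAt.comp z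
        ((hasFDerivAt_id z).const_sub y)
    rw [h1.fderiv]; simp
  have key := h.integral_inner_mul_fderiv hφ hφc (hts.trans hy) θ
  have e1 : ∫ t, ContinuousLinearMap.lsmul ℝ ℝ (w t) (fderiv ℝ r (y - t) θ)
      = ∫ z in Ω, (∑ i, ∑ j, θ i * θ j * G z (i, j)) * φ z := by
    rw [← neg_inj, ← key, ← integral_indicator hΩ.measurableSet, ← integral_neg]
    congr 1
    ext z
    by_cases hz : z ∈ Ω <;> simp [w, hz, hfd]
  rw [e1]
  refine (enorm_integral_le_lintegral_enorm _).trans ?_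
  rw [← lintegral_indicator hΩ.measurableSet]
  refine lintegral_mono_ae ?_
  filter_upwards [hg] with z hz
  by_cases hzΩ : z ∈ Ω
  · rw [indicator_of_mem hzΩ, enorm_mul, mul_comm]
    gcongr
    refine le_trans ?_ (hz hzΩ)
    rw [enorm_le_iff_norm_le]
    exact abs_sum_mul_mul_le_norm hθ _
  · simp [hzΩ]

open scoped Convolution in
-- Fundamental theorem of calculus for the smooth mollification. The upper limit is enlarged to
-- infinity so that the bound does not depend on `b`.
theorem HasWeakSymGradient.enorm_convolution_sub_le
    {Ω : Set (EuclideanSpace ℝ (Fin n))} {u : EuclideanSpace ℝ (Fin n) → EuclideanSpace ℝ (Fin n)}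
    {G : EuclideanSpace ℝ (Fin n) → EuclideanSpace ℝ (Fin n × Fin n)}
    (h : HasWeakSymGradient Ω u G) (hΩ : IsOpen Ω)
    {θ : EuclideanSpace ℝ (Fin n)} (hθ : ‖θ‖ = 1)
    (hu : LocallyIntegrable (Ω.indicator fun z => inner ℝ θ (u z)))
    {g : EuclideanSpace ℝ (Fin n) → ℝ≥0∞} (hg : ∀ᵐ z, z ∈ Ω → ‖G z‖ₑ ≤ g z)
    (ρ : ContDiffBump (0 : EuclideanSpace ℝ (Fin n))) {x : EuclideanSpace ℝ (Fin n)} {a b : ℝ}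
    (hab : a ≤ b) (hy : ∀ t ∈ Icc a b, Metric.closedBall (x + t • θ) ρ.rOut ⊆ Ω) :
    ‖(Ω.indicator (fun z => inner ℝ θ (u z)) ⋆[ContinuousLinearMap.lsmul ℝ ℝ]
        ρ.normed volume) (x + b • θ) -
      (Ω.indicator (fun z => inner ℝ θ (u z)) ⋆[ContinuousLinearMap.lsmul ℝ ℝ]
        ρ.normed volume) (x + a • θ)‖ₑ
      ≤ ∫⁻ t in Ioi a, ∫⁻ z, ‖ρ.normed volume (x + t • θ - z)‖ₑ * g z := by
  set H := Ω.indicator (fun z => inner ℝ θ (u z)) ⋆[ContinuousLinearMap.lsmul ℝ ℝ]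
        ρ.normed volume with hH
  have hH1 : ContDiff ℝ 1 H := ρ.hasCompactSupport_normed.contDiff_convolution_right
    (ContinuousLinearMap.lsmul ℝ ℝ) hu (ρ.contDiff_normed (n := 1))
  have hd : ∀ t : ℝ, HasDerivAt (fun t : ℝ => H (x + t • θ)) (fderiv ℝ H (x + t • θ) θ) t := by
    intro t
    have h1 : HasDerivAt (fun t : ℝ => x + t • θ) θ t := by
      simpa using ((hasDerivAt_id t).smul_const θ).const_add x
    exact ((hH1.differentiable (by simp)) (x + t • θ)).hasFDerivAt.comp_hasDerivAt t h1
  have hcont : Continuous fun t : ℝ => fderiv ℝ H (x + t • θ) θ :=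
    ((hH1.continuous_fderiv (by simp)).comp (by fun_prop)).clm_apply continuous_const
  have hftc := intervalIntegral.integral_eq_sub_of_hasDerivAt (fun t _ => hd t)
    (hcont.intervalIntegrable a b)
  rw [← hftc, intervalIntegral.integral_of_le hab]
  refine (enorm_integral_le_lintegral_enorm _).trans ?_
  refine (setLIntegral_mono' measurableSet_Ioc fun t ht => ?_).trans
    (lintegral_mono_set Ioc_subset_Ioi_self)
  exact h.enorm_fderiv_convolution_le hΩ hθ hu hg ρ (hy t (Ioc_subset_Icc_self ht))

open scoped Convolution in
theorem HasWeakSymGradient.enorm_inner_sub_le_liminf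
    {Ω : Set (EuclideanSpace ℝ (Fin n))} {u : EuclideanSpace ℝ (Fin n) → EuclideanSpace ℝ (Fin n)}
    {G : EuclideanSpace ℝ (Fin n) → EuclideanSpace ℝ (Fin n × Fin n)}
    (h : HasWeakSymGradient Ω u G) (hΩ : IsOpen Ω) (hcont : ContinuousOn u Ω)
    {θ : EuclideanSpace ℝ (Fin n)} (hθ : ‖θ‖ = 1)
    (hu : LocallyIntegrable (Ω.indicator fun z => inner ℝ θ (u z)))
    {g : EuclideanSpace ℝ (Fin n) → ℝ≥0∞} (hg : ∀ᵐ z, z ∈ Ω → ‖G z‖ₑ ≤ g z)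
    {ρ : ℕ → ContDiffBump (0 : EuclideanSpace ℝ (Fin n))}
    (hρ : Tendsto (fun k => (ρ k).rOut) atTop (𝓝 0))
    {x : EuclideanSpace ℝ (Fin n)} {s : ℝ} (hs : 0 < s)
    (hseg : ∀ t ∈ Icc 0 s, x + t • θ ∈ Ω) :
    ‖inner ℝ θ (u (x + s • θ)) - inner ℝ θ (u x)‖ₑ ≤ liminf (fun k => ∫⁻ t in Ioi (ρ k).rOut,
      ∫⁻ z, ‖(ρ k).normed volume (x + t • θ - z)‖ₑ * g z) atTop := by
  set w := Ω.indicator fun z => inner ℝ θ (u z) with hw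
  have hwc : ∀ z ∈ Ω, ContinuousAt w z := by
    intro z hz
    have h1 : ContinuousAt (fun z => inner ℝ θ (u z)) z :=
      continuousAt_const.inner (hcont.continuousAt (hΩ.mem_nhds hz))
    refine h1.congr ?_
    filter_upwards [hΩ.mem_nhds hz] with y hy
    rw [hw, indicator_of_mem hy]
  -- Convergence is needed along moving points, because the lower endpoint `x + (ρ k).rOut • θ`
  -- depends on `k`.
  have hlim : ∀ (p : ℕ → EuclideanSpace ℝ (Fin n)) (z : EuclideanSpace ℝ (Fin n)), z ∈ Ω →
      Tendsto p atTop (𝓝 z) →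
      Tendsto (fun k => (w ⋆[ContinuousLinearMap.lsmul ℝ ℝ] (ρ k).normed volume) (p k)) atTop
        (𝓝 (inner ℝ θ (u z))) := by
    intro p z hz hp
    have h1 := ContDiffBump.convolution_tendsto_right (μ := volume) (g := fun _ : ℕ => w) hρ
      (Eventually.of_forall fun _ => hu.aestronglyMeasurable) (z₀ := w z)
      ((hwc z hz).tendsto.comp tendsto_snd) hp
    rw [hw, indicator_of_mem hz, ← hw] at h1
    refine h1.congr fun k => ?_
    rw [← convolution_flip]
    congr 2
    ext; simp
  have hseg0 : x ∈ Ω := by simpa using hseg 0 ⟨le_rfl, hs.le⟩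
  have hpx : Tendsto (fun k => x + (ρ k).rOut • θ) atTop (𝓝 x) := by
    simpa using (hρ.smul_const θ).const_add x
  have hL := ((hlim (fun _ => x + s • θ) _ (hseg s ⟨hs.le, le_rfl⟩) tendsto_const_nhds).sub
    (hlim _ x hseg0 hpx)).enorm
  rw [← hL.liminf_eq]
  refine liminf_le_liminf ?_
  have hK : IsCompact ((fun t : ℝ => x + t • θ) '' Icc 0 s) :=
    isCompact_Icc.image (by fun_prop)
  -- A compact segment has a uniform neighbourhood in `Ω`, which eventually contains all the
  -- mollification balls.
  obtain ⟨δ, hδ, hδΩ⟩ := hK.exists_cthickening_subset_open hΩ (by rintro _ ⟨t, ht, rfl⟩; exact hseg t ht)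
  filter_upwards [hρ.eventually_lt_const hδ, hρ.eventually_lt_const hs] with k hk hks
  have hball : ∀ t ∈ Icc (ρ k).rOut s, Metric.closedBall (x + t • θ) (ρ k).rOut ⊆ Ω :=
    fun t ht => ((Metric.closedBall_subset_closedBall hk.le).trans
      (Metric.closedBall_subset_cthickening (mem_image_of_mem (fun t : ℝ => x + t • θ)
        (show t ∈ Icc 0 s from ⟨(ρ k).rOut_pos.le.trans ht.1, ht.2⟩)) δ)).trans hδΩ
  have hfin := h.enorm_convolution_sub_le hΩ hθ hu hg (ρ k) hks.le hball
  exact hfin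

/-- Continuity up to the boundary and bounded support make the zero extension globally bounded, even
when `Ω` is unbounded. -/
theorem MemCb.locallyIntegrable_indicator_inner
    {Ω : Set (EuclideanSpace ℝ (Fin n))} {u : EuclideanSpace ℝ (Fin n) → EuclideanSpace ℝ (Fin n)}
    (h : MemCb Ω u) (hΩ : IsOpen Ω) (θ : EuclideanSpace ℝ (Fin n)) :
    LocallyIntegrable (Ω.indicator fun z => inner ℝ θ (u z)) := by
  obtain ⟨hc, hb⟩ := h
  have hcw : ContinuousOn (fun z => inner ℝ θ (u z)) (closure Ω) := continuousOn_const.inner hc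
  obtain ⟨R, hR⟩ := hb.subset_closedBall 0
  have hK : IsCompact (closure Ω ∩ Metric.closedBall 0 R) :=
    (isCompact_closedBall 0 R).inter_left isClosed_closure
  obtain ⟨M, hM⟩ := hK.exists_bound_of_continuousOn (hcw.mono inter_subset_left)
  refine (locallyIntegrable_const (max M 0)).mono
    ((aestronglyMeasurable_indicator_iff hΩ.measurableSet).2
      ((hcw.mono subset_closure).aestronglyMeasurable hΩ.measurableSet)) (Eventually.of_forall fun z => ?_)
  rw [Real.norm_of_nonneg (le_max_right M 0)]
  by_cases hz : z ∈ Ω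
  · rw [indicator_of_mem hz]
    by_cases hu : u z = 0
    · simp [hu]
    · exact (hM z ⟨subset_closure hz, hR ⟨subset_closure hz, hu⟩⟩).trans (le_max_left _ _)
  · simp [hz]

/-- Otherwise `Ω` and the complement of its closure would disconnect a segment. -/
theorem mem_of_forall_notMem_hitTimes {Ω : Set (EuclideanSpace ℝ (Fin n))} (hΩ : IsOpen Ω)
    {x θ : EuclideanSpace ℝ (Fin n)} (hx : x ∈ Ω) (h : ¬ (hitTimes Ω x θ).Nonempty)
    {t : ℝ} (ht : 0 ≤ t) : x + t • θ ∈ Ω := by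
  have hcl : ∀ {s : ℝ}, 0 ≤ s → x + s • θ ∉ Ω → x + s • θ ∉ closure Ω := by
    intro s hs h1 h2
    rcases hs.eq_or_lt with rfl | hs
    · exact h1 (by simpa using hx)
    · exact h ⟨s, hs, by rw [hΩ.frontier_eq]; exact ⟨h2, h1⟩⟩
  by_contra hn
  have hpre : IsPreconnected ((fun t : ℝ => x + t • θ) '' Icc 0 t) :=
    isPreconnected_Icc.image _ (by fun_prop)
  obtain ⟨y, -, hy1, hy2⟩ := hpre Ω (closure Ω)ᶜ hΩ isClosed_closure.isOpen_compl
    (by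
      rintro _ ⟨s, hs, rfl⟩
      by_cases h1 : x + s • θ ∈ Ω
      · exact Or.inl h1
      · exact Or.inr (hcl hs.1 h1))
    ⟨x, ⟨0, ⟨le_rfl, ht⟩, by simp⟩, hx⟩ ⟨_, ⟨t, ⟨ht, le_rfl⟩, rfl⟩, hcl ht hn⟩
  exact hy2 (subset_closure hy1)

/-- Pointwise bound of a component along a ray by the boundary value and the limit of the
mollified symmetric gradients integrated along the ray. -/
theorem HasWeakSymGradient.enorm_inner_le_boundaryValue_add
    {Ω : Set (EuclideanSpace ℝ (Fin n))} {u : EuclideanSpace ℝ (Fin n) → EuclideanSpace ℝ (Fin n)}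
    {G : EuclideanSpace ℝ (Fin n) → EuclideanSpace ℝ (Fin n × Fin n)}
    (h : HasWeakSymGradient Ω u G) (hΩ : IsOpen Ω) (hu : MemCb Ω u)
    {θ : EuclideanSpace ℝ (Fin n)} (hθ : ‖θ‖ = 1)
    {g : EuclideanSpace ℝ (Fin n) → ℝ≥0∞} (hg : ∀ᵐ z, z ∈ Ω → ‖G z‖ₑ ≤ g z)
    {ρ : ℕ → ContDiffBump (0 : EuclideanSpace ℝ (Fin n))}
    (hρ : Tendsto (fun k => (ρ k).rOut) atTop (𝓝 0))
    {x : EuclideanSpace ℝ (Fin n)} (hx : x ∈ Ω) :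
    ‖inner ℝ θ (u x)‖ₑ ≤ ‖boundaryValue Ω u x θ‖ₑ + liminf (fun k => ∫⁻ t in Ioi (ρ k).rOut,
      ∫⁻ z, ‖(ρ k).normed volume (x + t • θ - z)‖ₑ * g z) atTop := by
  set J := liminf (fun k => ∫⁻ t in Ioi (ρ k).rOut,
      ∫⁻ z, ‖(ρ k).normed volume (x + t • θ - z)‖ₑ * g z) atTop
  have key : ∀ s : ℝ, 0 < s → (∀ t ∈ Icc 0 s, x + t • θ ∈ Ω) →
      ‖inner ℝ θ (u x)‖ₑ ≤ ‖u (x + s • θ)‖ₑ + J := by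
    intro s hs hseg
    have h1 := h.enorm_inner_sub_le_liminf hΩ (hu.1.mono subset_closure) hθ
      (hu.locallyIntegrable_indicator_inner hΩ θ) hg hρ hs hseg
    have h2 : ‖inner ℝ θ (u (x + s • θ))‖ₑ ≤ ‖u (x + s • θ)‖ₑ := by
      rw [enorm_le_iff_norm_le]
      simpa [hθ] using norm_inner_le_norm (𝕜 := ℝ) θ (u (x + s • θ))
    calc ‖inner ℝ θ (u x)‖ₑ
        = ‖inner ℝ θ (u (x + s • θ)) - (inner ℝ θ (u (x + s • θ)) - inner ℝ θ (u x))‖ₑ := by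
          rw [sub_sub_cancel]
      _ ≤ _ := (enorm_sub_le).trans (add_le_add h2 h1)
  unfold boundaryValue
  split_ifs with hne
  · obtain ⟨h0, hfr, hin⟩ := firstHit_spec hΩ hx hne
    set τ := sInf (hitTimes Ω x θ)
    -- The segment estimate needs the endpoint inside `Ω`; continuity of `u` on the closure lets it
    -- tend to the boundary point.
    have hc : Tendsto (fun s : ℝ => x + s • θ) (𝓝[<] τ) (𝓝[closure Ω] (firstHit Ω x θ)) := by
      refine tendsto_nhdsWithin_iff.2 ⟨?_, ?_⟩
      · have : Continuous fun s : ℝ => x + s • θ := by fun_prop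
        exact (this.tendsto τ).mono_left nhdsWithin_le_nhds
      · filter_upwards [Ioo_mem_nhdsLT h0] with s hs
        exact subset_closure (hin s hs)
    have hlim := (((hu.1 _ (frontier_subset_closure hfr)).tendsto.comp hc).enorm).add
      (tendsto_const_nhds (x := J))
    refine ge_of_tendsto hlim ?_
    filter_upwards [Ioo_mem_nhdsLT h0] with s hs
    refine key s hs.1 fun t ht => ?_
    rcases ht.1.eq_or_lt with rfl | h0t
    · simpa using hx
    · exact hin t ⟨h0t, ht.2.trans_lt hs.2⟩
  · have hin : ∀ t : ℝ, 0 ≤ t → x + t • θ ∈ Ω := fun t ht =>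
      mem_of_forall_notMem_hitTimes hΩ hx hne ht
    -- The ray never leaves `Ω`, so it can be stopped beyond the bounded support, where `u`
    -- vanishes.
    obtain ⟨R, hR⟩ := hu.2.subset_closedBall x
    have hs : 0 < |R| + 1 := by positivity
    have hz : u (x + (|R| + 1) • θ) = 0 := by
      by_contra hne
      have := hR ⟨subset_closure (hin _ hs.le), hne⟩
      rw [Metric.mem_closedBall, dist_eq_norm, add_sub_cancel_left, norm_smul, hθ, mul_one,
        Real.norm_of_nonneg hs.le] at this
      linarith [le_abs_self R]
    simpa [hz] using key _ hs fun t ht => hin t ht.1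

end WeakSymGradient

/-! ### Polar coordinates and the spherical measure. -/

section Polar

variable {E : Type*} [NormedAddCommGroup E] [NormedSpace ℝ E] [FiniteDimensional ℝ E]
  [MeasurableSpace E] [BorelSpace E] [Nontrivial E] (μ : Measure E) [μ.IsAddHaarMeasure]

/-- Integration in polar coordinates. -/
theorem lintegral_toSphere_lintegral_Ioi {f : E → ℝ≥0∞} (hf : Measurable f) :
    ∫⁻ θ : Metric.sphere (0 : E) 1, (∫⁻ t in Ioi (0 : ℝ), f (t • (θ : E))) ∂μ.toSphere
      = ∫⁻ y, f y / ‖y‖ₑ ^ (Module.finrank ℝ E - 1) ∂μ := by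
  set d := Module.finrank ℝ E - 1
  set F : E → ℝ≥0∞ := fun y => f y / ‖y‖ₑ ^ d with hF
  have hFm : Measurable F := hf.div (measurable_enorm.pow_const d)
  -- The origin is null, and the polar homeomorphism lives on its complement.
  have e1 : ∫⁻ y, F y ∂μ = ∫⁻ y : ({0}ᶜ : Set E), F y ∂(μ.comap (↑)) := by
    rw [lintegral_subtype_comap (measurableSet_singleton _).compl, restrict_compl_singleton]
  rw [e1]
  have e2 := (μ.measurePreserving_homeomorphUnitSphereProd).lintegral_comp_emb
    (Homeomorph.measurableEmbedding _)
    (fun p : Metric.sphere (0 : E) 1 × Ioi (0 : ℝ) => F ((p.2 : ℝ) • (p.1 : E)))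
  have e3 : ∀ y : ({0}ᶜ : Set E), F (((homeomorphUnitSphereProd E y).2 : ℝ) •
      ((homeomorphUnitSphereProd E y).1 : E)) = F y := by
    intro y
    rw [← homeomorphUnitSphereProd_symm_apply_coe, Homeomorph.symm_apply_apply]
  simp_rw [e3] at e2
  rw [e2, lintegral_prod _ (by
    refine (hFm.comp ?_).aemeasurable
    fun_prop)]
  refine lintegral_congr fun θ => ?_
  have hθm : Measurable fun t : Ioi (0 : ℝ) => F ((t : ℝ) • (θ : E)) := hFm.comp (by fun_prop)
  rw [Measure.volumeIoiPow, lintegral_withDensity_eq_lintegral_mul _ (by fun_prop) hθm,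
    ← lintegral_subtype_comap measurableSet_Ioi]
  refine lintegral_congr fun t => ?_
  have ht : (0 : ℝ) < t := t.2
  have hn : ‖(t : ℝ) • (θ : E)‖ₑ = ENNReal.ofReal t := by
    rw [← ofReal_norm, norm_smul, norm_eq_of_mem_sphere, mul_one, Real.norm_of_nonneg ht.le]
  simp only [Pi.mul_apply, hF, hn]
  rw [ENNReal.ofReal_pow ht.le, ENNReal.mul_div_cancel (by simpa using fun h => absurd h ht.not_ge) (by simp)]

/-- If `‖y‖ > ε` and `z` is within `ε` of `x + y`, then `‖x - z‖ ≤ 2‖y‖`, so the kernel at `y` is at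
most `2^d` times the kernel at `x - z`. Tonelli and the unit mass of the mollifier finish. -/
theorem lintegral_toSphere_lintegral_mollified_le {g : E → ℝ≥0∞} (hg : Measurable g)
    [HasContDiffBump E] (ρ : ContDiffBump (0 : E)) (x : E) :
    ∫⁻ θ : Metric.sphere (0 : E) 1, (∫⁻ t in Ioi ρ.rOut,
        ∫⁻ z, ‖ρ.normed μ (x + t • (θ : E) - z)‖ₑ * g z ∂μ) ∂μ.toSphere
      ≤ 2 ^ (Module.finrank ℝ E - 1) *
        ∫⁻ z, g z / ‖x - z‖ₑ ^ (Module.finrank ℝ E - 1) ∂μ := by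
  set d := Module.finrank ℝ E - 1
  set ε := ρ.rOut with hε
  have hε0 : 0 < ε := ρ.rOut_pos
  have hρ : Measurable (fun y => ‖ρ.normed μ y‖ₑ) := ρ.continuous_normed.measurable.enorm
  set K : E → E → ℝ≥0∞ := fun y z => ‖ρ.normed μ (x + y - z)‖ₑ * g z with hK
  have hKm : Measurable (Function.uncurry K) :=
    (hρ.comp ((measurable_const.add measurable_fst).sub measurable_snd)).mul (hg.comp measurable_snd)
  set S : Set E := {y | ε < ‖y‖} with hS
  have hSm : MeasurableSet S := measurableSet_lt measurable_const measurable_norm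
  set f : E → ℝ≥0∞ := S.indicator fun y => ∫⁻ z, K y z ∂μ with hf
  have hfm : Measurable f := (hKm.lintegral_prod_right').indicator hSm
  have e1 : ∀ θ : Metric.sphere (0 : E) 1, ∫⁻ t in Ioi ε, ∫⁻ z, K (t • (θ : E)) z ∂μ
      = ∫⁻ t in Ioi (0 : ℝ), f (t • (θ : E)) := by
    intro θ
    rw [← lintegral_indicator measurableSet_Ioi, ← lintegral_indicator measurableSet_Ioi]
    refine lintegral_congr fun t => ?_
    by_cases h0 : 0 < t
    · have hn : ‖t • (θ : E)‖ = t := by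
        rw [norm_smul, norm_eq_of_mem_sphere, mul_one, Real.norm_of_nonneg h0.le]
      by_cases ht : ε < t
      · simp [f, S, hn, h0, ht]
      · simp [f, S, hn, h0, ht]
    · have : ¬ ε < t := fun h => h0 (hε0.trans h)
      simp [h0, this]
  calc _ = ∫⁻ θ : Metric.sphere (0 : E) 1, (∫⁻ t in Ioi (0 : ℝ), f (t • (θ : E))) ∂μ.toSphere :=
        lintegral_congr e1
    _ = ∫⁻ y, f y / ‖y‖ₑ ^ d ∂μ := lintegral_toSphere_lintegral_Ioi μ hfm
    _ = ∫⁻ y, ∫⁻ z, S.indicator (fun y => K y z / ‖y‖ₑ ^ d) y ∂μ ∂μ := by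
        refine lintegral_congr fun y => ?_
        by_cases hy : y ∈ S
        · simp only [f, indicator_of_mem hy, div_eq_mul_inv]
          rw [lintegral_mul_const _ (hKm.of_uncurry_left)]
        · simp [f, hy]
    _ ≤ ∫⁻ y, ∫⁻ z, ‖ρ.normed μ (y + (x - z))‖ₑ * (2 ^ d * (g z / ‖x - z‖ₑ ^ d)) ∂μ ∂μ := by
        refine lintegral_mono fun y => lintegral_mono fun z => ?_
        by_cases hy : y ∈ S
        swap
        · simp [hy]
        simp only [indicator_of_mem hy, hK]
        rw [show x + y - z = y + (x - z) by abel]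
        by_cases h0 : ρ.normed μ (y + (x - z)) = 0
        · simp [h0]
        have hb : ‖y + (x - z)‖ < ε := by
          have : y + (x - z) ∈ Function.support (ρ.normed μ) := h0
          rw [ρ.support_normed_eq] at this
          simpa using this
        have hxz : ‖x - z‖ ≤ 2 * ‖y‖ := by
          have h1 : ‖x - z‖ ≤ ‖y + (x - z)‖ + ‖y‖ := by
            simpa using norm_sub_le (y + (x - z)) y
          have h2 : ε < ‖y‖ := hy
          linarith
        have hxz' : ‖x - z‖ₑ ≤ 2 * ‖y‖ₑ := by
          rw [← ofReal_norm, ← ofReal_norm, ← ENNReal.ofReal_ofNat 2,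
            ← ENNReal.ofReal_mul (by norm_num)]
          exact ENNReal.ofReal_le_ofReal hxz
        have hinv : (‖y‖ₑ ^ d)⁻¹ ≤ 2 ^ d * (‖x - z‖ₑ ^ d)⁻¹ := by
          rw [← div_eq_mul_inv, ENNReal.le_div_iff_mul_le (by simp) (by simp)]
          calc (‖y‖ₑ ^ d)⁻¹ * ‖x - z‖ₑ ^ d ≤ (‖y‖ₑ ^ d)⁻¹ * (2 * ‖y‖ₑ) ^ d := by gcongr
            _ = (‖y‖ₑ ^ d)⁻¹ * ‖y‖ₑ ^ d * 2 ^ d := by rw [mul_pow]; ring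
            _ ≤ 1 * 2 ^ d := by gcongr; exact ENNReal.inv_mul_le_one _
            _ = 2 ^ d := one_mul _
        calc ‖ρ.normed μ (y + (x - z))‖ₑ * g z / ‖y‖ₑ ^ d
            = ‖ρ.normed μ (y + (x - z))‖ₑ * g z * (‖y‖ₑ ^ d)⁻¹ := div_eq_mul_inv _ _
          _ ≤ ‖ρ.normed μ (y + (x - z))‖ₑ * g z * (2 ^ d * (‖x - z‖ₑ ^ d)⁻¹) := by gcongr
          _ = _ := by rw [div_eq_mul_inv]; ring
    _ = ∫⁻ z, ∫⁻ y, ‖ρ.normed μ (y + (x - z))‖ₑ * (2 ^ d * (g z / ‖x - z‖ₑ ^ d)) ∂μ ∂μ := by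
        refine lintegral_lintegral_swap (Measurable.aemeasurable ?_)
        refine (hρ.comp (measurable_fst.add (measurable_const.sub measurable_snd))).mul
          (measurable_const.mul ?_)
        exact (hg.comp measurable_snd).div
          ((measurable_const.sub measurable_snd).enorm.pow_const d)
    _ = ∫⁻ z, 2 ^ d * (g z / ‖x - z‖ₑ ^ d) ∂μ := by
        refine lintegral_congr fun z => ?_
        rw [lintegral_mul_const _ (by exact hρ.comp (measurable_id.add measurable_const)),
          lintegral_add_right_eq_self (fun y => ‖ρ.normed μ y‖ₑ) (x - z)]
        have : ∫⁻ y, ‖ρ.normed μ y‖ₑ ∂μ = 1 := by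
          rw [← ofReal_integral_norm_eq_lintegral_enorm ρ.integrable_normed]
          simp_rw [Real.norm_of_nonneg (ρ.nonneg_normed _)]
          rw [ρ.integral_normed, ENNReal.ofReal_one]
        rw [this, one_mul]
    _ = _ := lintegral_const_mul _
        (hg.div ((measurable_const.sub measurable_id).enorm.pow_const d))

open scoped Pointwise in
-- The spherical measure is a multiple of the volume of the cone over `s`. That cone stays close to
-- one radius, so about `1/r` balls of radius `2r` cover it.
theorem toSphere_le_of_ediam_le {s : Set (Metric.sphere (0 : E) 1)} (hs : IsClosed s) {r : ℝ}
    (hr : 0 < r) (hr1 : r ≤ 1) (hd : Metric.ediam s ≤ ENNReal.ofReal r) :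
    μ.toSphere s ≤ Module.finrank ℝ E * 2 ^ (Module.finrank ℝ E + 1) * μ (Metric.ball 0 1) *
      ENNReal.ofReal r ^ (Module.finrank ℝ E - 1) := by
  rcases s.eq_empty_or_nonempty with rfl | ⟨θ₀, hθ₀⟩
  · simp
  rw [μ.toSphere_apply' hs.measurableSet]
  set d := Module.finrank ℝ E
  have hd0 : 0 < d := Module.finrank_pos
  set N := ⌊1 / r⌋₊
  have hcover : Ioo (0 : ℝ) 1 • ((↑) '' s : Set E)
      ⊆ ⋃ k ∈ Finset.range (N + 1), Metric.closedBall ((k * r : ℝ) • (θ₀ : E)) (2 * r) := by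
    rintro _ ⟨t, ht, _, ⟨θ, hθ, rfl⟩, rfl⟩
    simp only [mem_iUnion, Finset.mem_range]
    refine ⟨⌊t / r⌋₊, Nat.lt_succ_of_le (Nat.floor_le_floor (by gcongr; exact ht.2.le)), ?_⟩
    have h1 : (⌊t / r⌋₊ : ℝ) * r ≤ t := by
      rw [← le_div_iff₀ hr]; exact Nat.floor_le (by have := ht.1; positivity)
    have h2 : t ≤ (⌊t / r⌋₊ + 1 : ℝ) * r := by
      rw [← div_le_iff₀ hr]; exact (Nat.lt_floor_add_one _).le
    have h3 : ‖(θ : E) - θ₀‖ ≤ r := by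
      have := (Metric.edist_le_ediam_of_mem hθ hθ₀).trans hd
      rw [edist_le_ofReal hr.le] at this
      rwa [← dist_eq_norm, ← Subtype.dist_eq]
    have h4 : |t - ⌊t / r⌋₊ * r| ≤ r := by rw [abs_le]; constructor <;> linarith
    rw [Metric.mem_closedBall, dist_eq_norm]
    calc ‖t • (θ : E) - (⌊t / r⌋₊ * r : ℝ) • (θ₀ : E)‖
        = ‖t • ((θ : E) - θ₀) + (t - ⌊t / r⌋₊ * r) • (θ₀ : E)‖ := by
          congr 1; rw [smul_sub, sub_smul]; abel
      _ ≤ ‖t • ((θ : E) - θ₀)‖ + ‖(t - ⌊t / r⌋₊ * r) • (θ₀ : E)‖ := norm_add_le _ _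
      _ = |t| * ‖(θ : E) - θ₀‖ + |t - ⌊t / r⌋₊ * r| := by
          rw [norm_smul, norm_smul, norm_eq_of_mem_sphere, mul_one]; rfl
      _ ≤ 1 * r + r := by
          gcongr
          rw [abs_of_pos ht.1]; exact ht.2.le
      _ = 2 * r := by ring
  -- The number of balls uses up one of the `d` powers of `r`.
  have hN : ((N : ℝ) + 1) * (2 * r) ^ d ≤ 2 ^ (d + 1) * r ^ (d - 1) := by
    have h1 : (N : ℝ) ≤ 1 / r := Nat.floor_le (by positivity)
    have h2 : ((N : ℝ) + 1) * r ≤ 2 := by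
      have : (N : ℝ) * r ≤ 1 := by rwa [← le_div_iff₀ hr]
      linarith
    obtain ⟨m, hm⟩ : ∃ m, d = m + 1 := ⟨d - 1, by omega⟩
    rw [hm, Nat.add_sub_cancel]
    calc ((N : ℝ) + 1) * (2 * r) ^ (m + 1) = (((N : ℝ) + 1) * r) * (2 ^ (m + 1) * r ^ m) := by ring
      _ ≤ 2 * (2 ^ (m + 1) * r ^ m) := by gcongr
      _ = _ := by ring
  calc (d : ℝ≥0∞) * μ (Ioo (0 : ℝ) 1 • ((↑) '' s : Set E))
      ≤ d * ∑ k ∈ Finset.range (N + 1), μ (Metric.closedBall ((k * r : ℝ) • (θ₀ : E)) (2 * r)) := by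
        gcongr
        exact (measure_mono hcover).trans (measure_biUnion_finset_le _ _)
    _ = d * (ENNReal.ofReal (((N : ℝ) + 1) * (2 * r) ^ d) * μ (Metric.ball 0 1)) := by
        congr 1
        simp_rw [μ.addHaar_closedBall _ (show (0 : ℝ) ≤ 2 * r by positivity)]
        rw [Finset.sum_const, Finset.card_range, nsmul_eq_mul, ENNReal.ofReal_mul (by positivity),
          ← mul_assoc]
        congr 2
        rw [← Nat.cast_succ, ENNReal.ofReal_natCast]
    _ ≤ d * (ENNReal.ofReal (2 ^ (d + 1) * r ^ (d - 1)) * μ (Metric.ball 0 1)) := by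
        gcongr
    _ = _ := by
        rw [ENNReal.ofReal_mul (by positivity), ENNReal.ofReal_pow (by positivity),
          ENNReal.ofReal_pow hr.le, ENNReal.ofReal_ofNat]
        ring

/-- The spherical measure is dominated by the Hausdorff measure of codimension one. -/
theorem exists_toSphere_le_smul_hausdorffMeasure (hd : 2 ≤ Module.finrank ℝ E) :
    ∃ A : ℝ≥0, μ.toSphere ≤ A • μH[(Module.finrank ℝ E : ℝ) - 1] := by
  set d := Module.finrank ℝ E
  set B : ℝ≥0∞ := d * 2 ^ (d + 1) * μ (Metric.ball 0 1) with hB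
  have hBt : B ≠ ⊤ := by
    refine ENNReal.mul_ne_top (ENNReal.mul_ne_top (by simp) (by simp)) measure_ball_lt_top.ne
  have hB0 : B ≠ 0 := by
    have := (Metric.measure_ball_pos μ (0 : E) one_pos).ne'
    simp only [hB, ne_eq, mul_eq_zero, not_or]
    exact ⟨⟨by simp; omega, by simp⟩, this⟩
  have hcast : (d : ℝ) - 1 = ((d - 1 : ℕ) : ℝ) := by
    rw [Nat.cast_sub (by omega)]; simp
  have hsmall : ∀ s : Set (Metric.sphere (0 : E) 1), IsClosed s → Metric.ediam s ≤ 1 →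
      μ.toSphere s ≤ B * Metric.ediam s ^ ((d : ℝ) - 1) := by
    intro s hs hs1
    rw [hcast, ENNReal.rpow_natCast]
    -- The cone estimate requires a positive radius, so zero diameter is reached by letting the
    -- radius tend to 0.
    rcases eq_or_ne (Metric.ediam s) 0 with h0 | h0
    · have hlim : Tendsto (fun k : ℕ => B * ENNReal.ofReal (1 / ((k : ℝ) + 1)) ^ (d - 1)) atTop
          (𝓝 (B * ENNReal.ofReal 0 ^ (d - 1))) := by
        refine ENNReal.Tendsto.const_mul ?_ (Or.inr hBt)
        exact (ENNReal.continuous_pow _).continuousAt.tendsto.comp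
          (ENNReal.tendsto_ofReal tendsto_one_div_add_atTop_nhds_zero_nat)
      rw [h0, ← ENNReal.ofReal_zero]
      refine ge_of_tendsto' hlim fun k => ?_
      refine toSphere_le_of_ediam_le μ hs (by positivity) ?_ (by simp [h0])
      rw [div_le_one (by positivity)]
      linarith [(Nat.cast_nonneg k : (0 : ℝ) ≤ k)]
    · have ht : Metric.ediam s ≠ ⊤ := (hs1.trans_lt ENNReal.one_lt_top).ne
      have := toSphere_le_of_ediam_le μ hs (ENNReal.toReal_pos h0 ht)
        (by simpa using ENNReal.toReal_mono ENNReal.one_ne_top hs1) (by rw [ENNReal.ofReal_toReal ht])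
      rwa [ENNReal.ofReal_toReal ht] at this
  have hmain : B⁻¹ • μ.toSphere ≤ μH[(d : ℝ) - 1] := by
    -- Arbitrary small sets reduce to closed ones, since closure preserves the diameter.
    refine Measure.le_hausdorffMeasure _ _ 1 one_pos fun s hs => ?_
    rw [Measure.smul_apply, smul_eq_mul, mul_comm, ← div_eq_mul_inv,
      ENNReal.div_le_iff hB0 hBt, mul_comm, ← Metric.ediam_closure s]
    exact (measure_mono subset_closure).trans
      (hsmall _ isClosed_closure (by rwa [Metric.ediam_closure]))
  refine ⟨B.toNNReal, Measure.le_iff'.2 fun s => ?_⟩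
  have := hmain s
  rw [Measure.smul_apply, smul_eq_mul, mul_comm, ← div_eq_mul_inv, ENNReal.div_le_iff hB0 hBt] at this
  rw [Measure.smul_apply, ENNReal.smul_def, ENNReal.coe_toNNReal hBt, smul_eq_mul, mul_comm]
  exact this

end Polar

/-! ### Averaging over directions and conclusion. -/

/-- The average is continuous and 1-homogeneous in `v`, and positive on the unit sphere because the
integrand is 1 at `θ = v`. By compactness its minimum there is a valid `c`. -/
theorem exists_mul_enorm_le_lintegral_toSphere_inner {E : Type*} [NormedAddCommGroup E]
    [InnerProductSpace ℝ E] [FiniteDimensional ℝ E] [MeasurableSpace E] [BorelSpace E]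
    [Nontrivial E] (μ : Measure E) [μ.IsAddHaarMeasure] :
    ∃ c : ℝ≥0, 0 < c ∧ ∀ v : E,
      c * ‖v‖ₑ ≤ ∫⁻ θ : Metric.sphere (0 : E) 1, ‖inner ℝ (θ : E) v‖ₑ ∂μ.toSphere := by
  set N : E → ℝ := fun v => ∫ θ : Metric.sphere (0 : E) 1, |inner ℝ (θ : E) v| ∂μ.toSphere with hN
  have hcont : Continuous N := by
    have h1 : Continuous (Function.uncurry fun (v : E) (θ : Metric.sphere (0 : E) 1) =>
        |inner ℝ (θ : E) v|) := by
      simp only [Function.uncurry_def]; fun_prop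
    simpa using continuous_parametric_integral_of_continuous (μ := μ.toSphere) h1 isCompact_univ
  have hint : ∀ v, Integrable (fun θ : Metric.sphere (0 : E) 1 => |inner ℝ (θ : E) v|)
      μ.toSphere := fun v =>
    (by fun_prop : Continuous fun θ : Metric.sphere (0 : E) 1 => |inner ℝ (θ : E) v|)
      |>.integrable_of_hasCompactSupport (HasCompactSupport.of_compactSpace _)
  obtain ⟨v₀, hv₀, hmin⟩ := (isCompact_sphere (0 : E) 1).exists_isMinOn
    (NormedSpace.sphere_nonempty.2 zero_le_one) hcont.continuousOn
  have hpos : 0 < N v₀ := by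
    refine Continuous.integral_pos_of_hasCompactSupport_nonneg_nonzero (x := ⟨v₀, hv₀⟩)
      (by fun_prop) (HasCompactSupport.of_compactSpace _) (fun θ => abs_nonneg _) ?_
    have : ‖v₀‖ = 1 := by simpa using hv₀
    simp [this]
  refine ⟨(N v₀).toNNReal, Real.toNNReal_pos.2 hpos, fun v => ?_⟩
  have hle : N v₀ * ‖v‖ ≤ N v := by
    rcases eq_or_ne v 0 with rfl | hv
    · simp [hN]
    have h1 : N v₀ ≤ N (‖v‖⁻¹ • v) := hmin (by simp [norm_smul, hv])
    have h2 : N (‖v‖⁻¹ • v) = ‖v‖⁻¹ * N v := by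
      simp only [hN, inner_smul_right, abs_mul, abs_inv, abs_norm, integral_const_mul]
    rw [h2, inv_mul_eq_div, le_div_iff₀ (norm_pos_iff.2 hv)] at h1
    exact h1
  calc ((N v₀).toNNReal : ℝ≥0∞) * ‖v‖ₑ = ENNReal.ofReal (N v₀ * ‖v‖) := by
        rw [ENNReal.ofReal_mul hpos.le, ofReal_norm]; rfl
    _ ≤ ENNReal.ofReal (N v) := ENNReal.ofReal_le_ofReal hle
    _ = _ := by
        have h3 := ofReal_integral_norm_eq_lintegral_enorm (hint v)
        simpa [hN] using h3

theorem theorem2p1 (n : ℕ) (hn : 2 ≤ n) :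
    ∃ C : ℝ≥0, 0 < C ∧
      ∀ Ω : Set (EuclideanSpace ℝ (Fin n)), IsOpen Ω →
      ∀ u : EuclideanSpace ℝ (Fin n) → EuclideanSpace ℝ (Fin n),
        MemE 1 Ω u → MemCb Ω u →
      ∀ G : EuclideanSpace ℝ (Fin n) → EuclideanSpace ℝ (Fin n × Fin n),
        HasWeakSymGradient Ω u G →
      ∀ x ∈ Ω,
        ‖u x‖ₑ ≤
          C * (∫⁻ θ in Metric.sphere (0 : EuclideanSpace ℝ (Fin n)) 1,
                ‖boundaryValue Ω u x θ‖ₑ ∂(Measure.hausdorffMeasure ((n : ℝ) - 1)))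
            + C * ∫⁻ y in Ω, ‖G y‖ₑ / ‖x - y‖ₑ ^ (n - 1) := by
  have : Nonempty (Fin n) := ⟨⟨0, by omega⟩⟩
  have hdim : Module.finrank ℝ (EuclideanSpace ℝ (Fin n)) = n := finrank_euclideanSpace_fin
  obtain ⟨c, hc, hcle⟩ := exists_mul_enorm_le_lintegral_toSphere_inner
    (volume : Measure (EuclideanSpace ℝ (Fin n)))
  obtain ⟨A, hA⟩ := exists_toSphere_le_smul_hausdorffMeasure
    (volume : Measure (EuclideanSpace ℝ (Fin n))) (by rwa [hdim])
  rw [hdim] at hA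
  -- `c` comes from averaging components, `A` from the Hausdorff comparison, `2^(n-1)` from
  -- mollifying the kernel; the sum serves both terms.
  refine ⟨c⁻¹ * (A + 2 ^ (n - 1)), by positivity, ?_⟩
  intro Ω hΩ u _ hu G hG x hx
  set I := ∫⁻ y in Ω, ‖G y‖ₑ / ‖x - y‖ₑ ^ (n - 1) with hI
  set D := ∫⁻ θ in Metric.sphere (0 : EuclideanSpace ℝ (Fin n)) 1,
                ‖boundaryValue Ω u x θ‖ₑ ∂(Measure.hausdorffMeasure ((n : ℝ) - 1)) with hD
  have hGm : AEMeasurable (fun y => ‖G y‖ₑ) (volume.restrict Ω) :=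
    hG.2.1.aestronglyMeasurable.enorm
  -- A Borel representative of `‖G‖ₑ`, extended by zero, as polar coordinates and Tonelli require.
  set g : EuclideanSpace ℝ (Fin n) → ℝ≥0∞ := Ω.indicator (hGm.mk _) with hg
  have hgm : Measurable g := hGm.measurable_mk.indicator hΩ.measurableSet
  have hGg : ∀ᵐ z, z ∈ Ω → ‖G z‖ₑ = hGm.mk _ z := (ae_restrict_iff' hΩ.measurableSet).1 hGm.ae_eq_mk
  have hle : ∀ᵐ z, z ∈ Ω → ‖G z‖ₑ ≤ g z := by
    filter_upwards [hGg] with z hz hzΩ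
    rw [hg, indicator_of_mem hzΩ, hz hzΩ]
  have hgI : ∫⁻ z, g z / ‖x - z‖ₑ ^ (n - 1) = I := by
    rw [hI, ← lintegral_indicator hΩ.measurableSet]
    refine lintegral_congr_ae ?_
    filter_upwards [hGg] with z hz
    by_cases hzΩ : z ∈ Ω
    · rw [indicator_of_mem hzΩ, hg, indicator_of_mem hzΩ, hz hzΩ]
    · simp [hg, hzΩ]
  set ρ : ℕ → ContDiffBump (0 : EuclideanSpace ℝ (Fin n)) := fun k =>
    ⟨1 / ((k : ℝ) + 1) / 2, 1 / ((k : ℝ) + 1), by positivity, half_lt_self (by positivity)⟩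
  have hρ : Tendsto (fun k => (ρ k).rOut) atTop (𝓝 0) := tendsto_one_div_add_atTop_nhds_zero_nat
  set J : ℕ → Metric.sphere (0 : EuclideanSpace ℝ (Fin n)) 1 → ℝ≥0∞ := fun k θ =>
    ∫⁻ t in Ioi (ρ k).rOut, ∫⁻ z, ‖(ρ k).normed volume (x + t • (θ : EuclideanSpace ℝ (Fin n)) - z)‖ₑ
      * g z with hJ
  have hJm : ∀ k, Measurable (J k) := by
    intro k
    have hr : Measurable (fun y => ‖(ρ k).normed volume y‖ₑ) :=
      (ρ k).continuous_normed.measurable.enorm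
    have h1 : Measurable fun p : (Metric.sphere (0 : EuclideanSpace ℝ (Fin n)) 1 × ℝ) ×
        EuclideanSpace ℝ (Fin n) =>
        ‖(ρ k).normed volume (x + p.1.2 • (p.1.1 : EuclideanSpace ℝ (Fin n)) - p.2)‖ₑ * g p.2 :=
      (hr.comp (by fun_prop)).mul (hgm.comp measurable_snd)
    exact h1.lintegral_prod_right'.lintegral_prod_right'
  have hJle : ∀ k, ∫⁻ θ, J k θ ∂(volume : Measure (EuclideanSpace ℝ (Fin n))).toSphere
      ≤ 2 ^ (n - 1) * I := by
    intro k
    have := lintegral_toSphere_lintegral_mollified_le volume hgm (ρ k) x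
    rwa [hdim, hgI] at this
  have hbd : ∫⁻ θ : Metric.sphere (0 : EuclideanSpace ℝ (Fin n)) 1, ‖boundaryValue Ω u x θ‖ₑ
      ∂(volume : Measure (EuclideanSpace ℝ (Fin n))).toSphere ≤ A * D := by
    refine (lintegral_mono' hA le_rfl).trans_eq ?_
    rw [lintegral_smul_measure, ENNReal.smul_def, smul_eq_mul]
    congr 1
    have h0 : (0 : ℝ) ≤ (n : ℝ) - 1 := by
      have : (2 : ℝ) ≤ n := by exact_mod_cast hn
      linarith
    -- The Hausdorff measure of the sphere as a metric space agrees with the ambient one restricted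
    -- to it.
    have h1 := (isometry_subtype_coe
      (s := Metric.sphere (0 : EuclideanSpace ℝ (Fin n)) 1)).map_hausdorffMeasure (Or.inl h0)
    rw [Subtype.range_coe] at h1
    rw [hD, ← h1, (MeasurableEmbedding.subtype_coe Metric.isClosed_sphere.measurableSet).lintegral_map]
  have hmain : c * ‖u x‖ₑ ≤ A * D + 2 ^ (n - 1) * I :=
    calc c * ‖u x‖ₑ
        ≤ ∫⁻ θ : Metric.sphere (0 : EuclideanSpace ℝ (Fin n)) 1,
            ‖inner ℝ (θ : EuclideanSpace ℝ (Fin n)) (u x)‖ₑ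
              ∂(volume : Measure (EuclideanSpace ℝ (Fin n))).toSphere := hcle _
      _ ≤ ∫⁻ θ : Metric.sphere (0 : EuclideanSpace ℝ (Fin n)) 1,
            (‖boundaryValue Ω u x θ‖ₑ + liminf (fun k => J k θ) atTop)
              ∂(volume : Measure (EuclideanSpace ℝ (Fin n))).toSphere :=
          lintegral_mono fun θ => hG.enorm_inner_le_boundaryValue_add hΩ hu
            (norm_eq_of_mem_sphere θ) hle hρ hx
      -- Only the liminf needs to be measurable here, not the boundary values.
      _ = _ + _ := lintegral_add_right _ (Measurable.liminf hJm)
      _ ≤ A * D + 2 ^ (n - 1) * I := by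
          -- Fatou's lemma, with a bound uniform in `k`.
          refine add_le_add hbd ((lintegral_liminf_le hJm).trans ?_)
          exact liminf_le_of_le (by isBoundedDefault) fun b hb => by
            obtain ⟨k, hk⟩ := hb.exists
            exact hk.trans (hJle k)
  have hc' : (c : ℝ≥0∞)⁻¹ * c = 1 :=
    ENNReal.inv_mul_cancel (by simpa using hc.ne') ENNReal.coe_ne_top
  calc ‖u x‖ₑ = (c : ℝ≥0∞)⁻¹ * (c * ‖u x‖ₑ) := by rw [← mul_assoc, hc', one_mul]
    _ ≤ (c : ℝ≥0∞)⁻¹ * ((A + 2 ^ (n - 1)) * D + (A + 2 ^ (n - 1)) * I) := by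
        gcongr
        refine hmain.trans (add_le_add ?_ ?_)
        · gcongr; exact le_self_add
        · gcongr; exact le_add_self
    _ = _ := by
        rw [ENNReal.coe_mul, ENNReal.coe_inv hc.ne']
        push_cast
        ring
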